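/- Let $\mathcal H$ be a complex Hilbert space with inner product linear in the second argument. A densely defined operator $B$ on $\mathcal H$ is called dissipative if $\operatorname{Im}\langle f,Bf\rangle\ge 0$ for all $f\in\mathcal D(B)$, and an operator $C$ is called accretive if $iC$ is dissipative. Let $S$ be a densely defined symmetric operator on $\mathcal H$ that is strictly positive, i.e. there is $\varepsilon>0$ with $\langle f,Sf\rangle\ge\varepsilon\|f\|^2$ for all $f\in\mathcal D(S)$, and put $A=iS$. Let $S_F$ be the Friedrichs extension of $S$ (the restriction of $S^*$ to the elements of $\mathcal D(S^*)$ lying in the domain of the closure of the form $f\mapsto\langle f,Sf\rangle$, $f\in\mathcal D(S)$), let $S_K$ be its Kreĭn–von Neumann extension, $S_K=S^*\upharpoonright_{\mathcal D(\overline S)\dot+\ker S^*}$, and let $S_K^{1/2}$ be the non-negative selfadjoint square root of $S_K$ (which exists, and $\mathcal D(S_F)\subset\mathcal D(S_K^{1/2})$). For a subspace $\mathcal V\subset\mathcal D(S_K^{1/2})$ with $\mathcal V\cap\mathcal D(A)=\{0\}$ and a linear operator $\mathcal L:\mathcal V\to\mathcal D(S_F)$ define $$A_{\mathcal V,\mathcal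 L}:\quad \mathcal D(A_{\mathcal V,\mathcal L})=\mathcal D(A)\dot+\mathcal V,\qquad f+v\mapsto iSf+iS_F\mathcal Lv\qquad(f\in\mathcal D(A),\ v\in\mathcal V).$$ For every such pair $(\mathcal V,\mathcal L)$, the operator $A_{\mathcal V,\mathcal L}$ is dissipative if and only if $$\operatorname{Re}\langle v,S_F\mathcal Lv\rangle\ \ge\ \tfrac14\,\|S_K^{1/2}(\mathcal Lv+v)\|^2\qquad\text{for all } v\in\mathcal V. \tag{$*$}$$ Moreover, an operator $B$ on $\mathcal H$ is a dissipative extension of $A$ if and only if $B=A_{\mathcal V,\mathcal L}$ for some such pair $(\mathcal V,\mathcal L)$ satisfying $(*)$. Equivalently, an operator $C$ on $\mathcal H$ is an accretive extension of $S$ if and only if $C=-iA_{\mathcal V,\mathcal L}$ for some such pair $(\mathcal V,\mathcal L)$ satisfying $(*)$. -/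

import Mathlib

noncomputable section

open Filter Topology Complex

namespace DissipativeExtension

variable {H : Type*} [NormedAddCommGroup H] [InnerProductSpace ℂ H]

/-- A densely defined operator `A` is dissipative if `Im ⟨f, A f⟩ ≥ 0` for all `f ∈ D(A)`. -/
structure IsDissipative (A : H →ₗ.[ℂ] H) : Prop where
  dense : Dense (A.domain : Set H)
  im_nonneg : ∀ f : A.domain, 0 ≤ (inner ℂ (f : H) (A f)).im

/-- An operator `C` is accretive if `i C` is dissipative. -/
def IsAccretive (C : H →ₗ.[ℂ] H) : Prop := IsDissipative (I • C)

/-- A densely defined symmetric operator `S` with `⟨f, S f⟩ ≥ ε ‖f‖²` on `D(S)` for some `ε > 0`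
(the number `⟨f, S f⟩` is real by symmetry). -/
structure IsStrictlyPositiveSymmetric (S : H →ₗ.[ℂ] H) : Prop where
  dense : Dense (S.domain : Set H)
  symmetric : S.IsFormalAdjoint S
  strictly_positive : ∃ ε : ℝ, 0 < ε ∧
    ∀ f : S.domain, ε * ‖(f : H)‖ ^ 2 ≤ (inner ℂ (f : H) (S f)).re

/-- The quadratic form `f ↦ ⟨f, S f⟩` of a symmetric operator, with domain `D(S)`. -/
def quadForm (S : H →ₗ.[ℂ] H) (f : S.domain) : ℝ := (inner ℂ (f : H) (S f)).re

theorem quadForm_add_add_sub (S : H →ₗ.[ℂ] H) (f g : S.domain) :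
    quadForm S (f + g) + quadForm S (f - g) = 2 * quadForm S f + 2 * quadForm S g := by
  simp only [quadForm, Submodule.coe_add, Submodule.coe_sub, LinearPMap.map_add,
    LinearPMap.map_sub, inner_add_left, inner_add_right, inner_sub_left, inner_sub_right,
    Complex.add_re, Complex.sub_re]
  ring

theorem quadForm_smul (S : H →ₗ.[ℂ] H) (c : ℂ) (f : S.domain) :
    quadForm S (c • f) = ‖c‖ ^ 2 * quadForm S f := by
  simp only [quadForm, Submodule.coe_smul, LinearPMap.map_smul, inner_smul_left,
    inner_smul_right]
  rw [← mul_assoc, Complex.mul_conj, Complex.re_ofReal_mul,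
    Complex.normSq_eq_norm_sq]

theorem IsStrictlyPositiveSymmetric.quadForm_nonneg {S : H →ₗ.[ℂ] H}
    (hS : IsStrictlyPositiveSymmetric S) (f : S.domain) : 0 ≤ quadForm S f := by
  obtain ⟨ε, hε, h⟩ := hS.strictly_positive
  exact le_trans (by positivity) (h f)

/-- The domain of the closure of the form `f ↦ ⟨f, S f⟩`: all limits in `H` of sequences in `D(S)`
that are Cauchy for the form. -/
def closedFormDomain {S : H →ₗ.[ℂ] H} (hS : IsStrictlyPositiveSymmetric S) : Submodule ℂ H where
  carrier := {f | ∃ u : ℕ → S.domain, Tendsto (fun n => (u n : H)) atTop (𝓝 f) ∧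
    Tendsto (fun p : ℕ × ℕ => quadForm S (u p.1 - u p.2)) atTop (𝓝 0)}
  zero_mem' := ⟨fun _ => 0, by simp, by simp [quadForm]⟩
  add_mem' := by
    rintro f g ⟨u, hu, hu'⟩ ⟨w, hw, hw'⟩
    refine ⟨fun n => u n + w n, by simpa using hu.add hw, ?_⟩
    have hlim : Tendsto (fun p : ℕ × ℕ =>
        2 * quadForm S (u p.1 - u p.2) + 2 * quadForm S (w p.1 - w p.2)) atTop (𝓝 0) := by
      simpa using (hu'.const_mul 2).add (hw'.const_mul 2)
    refine squeeze_zero (fun p => hS.quadForm_nonneg _) (fun p => ?_) hlim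
    rw [add_sub_add_comm, ← quadForm_add_add_sub]
    exact le_add_of_nonneg_right (hS.quadForm_nonneg _)
  smul_mem' := by
    rintro c f ⟨u, hu, hu'⟩
    refine ⟨fun n => c • u n, by simpa using hu.const_smul c, ?_⟩
    have hlim := hu'.const_mul (‖c‖ ^ 2)
    rw [mul_zero] at hlim
    refine hlim.congr fun p => ?_
    rw [← smul_sub, quadForm_smul]

variable [CompleteSpace H]

/-- The Friedrichs extension `S_F`: the restriction of `S*` to those elements of `D(S*)` that lie
in the domain of the closed form generated by `S`. -/
def friedrichs {S : H →ₗ.[ℂ] H} (hS : IsStrictlyPositiveSymmetric S) : H →ₗ.[ℂ] H :=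
  S.adjoint.domRestrict (closedFormDomain hS)

/-- The kernel of a partially defined operator, as a subspace of `H`. -/
def kernel (T : H →ₗ.[ℂ] H) : Submodule ℂ H := (LinearMap.ker T.toFun).map T.domain.subtype

/-- The Kreĭn–von Neumann extension `S_K`: the restriction of `S*` to `D(S̄) + ker S*`. -/
def krein (S : H →ₗ.[ℂ] H) : H →ₗ.[ℂ] H :=
  S.adjoint.domRestrict (S.closure.domain ⊔ kernel S.adjoint)

/-- `R` is a non-negative selfadjoint square root of `T`: one has `R² = T`, where
`D(R²) = {x ∈ D(R) | R x ∈ D(R)}`. -/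
structure IsNonnegSqrt (T R : H →ₗ.[ℂ] H) : Prop where
  selfAdjoint : IsSelfAdjoint R
  nonneg : ∀ x : R.domain, 0 ≤ (inner ℂ (x : H) (R x)).re
  sq_eq : ∀ x y : H, (x, y) ∈ T.graph ↔ ∃ z : H, (x, z) ∈ R.graph ∧ (z, y) ∈ R.graph

open Classical in
/-- The square root `T^{1/2}` of a non-negative selfadjoint operator `T`, i.e. its (unique)
non-negative selfadjoint square root; the value is `0` if there is none. -/
def sqrt (T : H →ₗ.[ℂ] H) : H →ₗ.[ℂ] H :=
  if h : ∃ R, IsNonnegSqrt T R then h.choose else 0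

/-- A pair `(𝒱, ℒ)`: a subspace `𝒱 ⊆ D(S_K^{1/2})` with `𝒱 ∩ D(S) = {0}` and a linear operator
`ℒ : 𝒱 → D(S_F)`. -/
structure ExtensionData {S : H →ₗ.[ℂ] H} (hS : IsStrictlyPositiveSymmetric S) where
  V : Submodule ℂ H
  V_le : V ≤ (sqrt (krein S)).domain
  disjoint : Disjoint S.domain V
  L : V →ₗ[ℂ] (friedrichs hS).domain

variable {S : H →ₗ.[ℂ] H} {hS : IsStrictlyPositiveSymmetric S}

/-- The operator `v ↦ i S_F ℒ v` with domain `𝒱`. -/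
def ExtensionData.onV (P : ExtensionData hS) : H →ₗ.[ℂ] H :=
  ⟨P.V, I • ((friedrichs hS).toFun ∘ₗ P.L)⟩

/-- The operator `A_{𝒱,ℒ}` with domain `D(S) ∔ 𝒱` and `f + v ↦ i S f + i S_F ℒ v`. -/
def ExtensionData.op (P : ExtensionData hS) : H →ₗ.[ℂ] H :=
  LinearPMap.sup (I • S) P.onV (LinearPMap.sup_h_of_disjoint _ _ P.disjoint)

/-- The condition `Re ⟨v, S_F ℒ v⟩ ≥ ¼ ‖S_K^{1/2} (ℒ v + v)‖²` for all `v ∈ 𝒱`, where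
`ℒ v + v ∈ D(S_K^{1/2})` is included for the right-hand side to make sense. -/
def ExtensionData.Condition (P : ExtensionData hS) : Prop :=
  ∀ v : P.V, ∃ h : (P.L v : H) + (v : H) ∈ (sqrt (krein S)).domain,
    (1 / 4 : ℝ) * ‖sqrt (krein S) ⟨(P.L v : H) + (v : H), h⟩‖ ^ 2 ≤
      (inner ℂ (v : H) (friedrichs hS (P.L v))).re

end DissipativeExtension

end

open DissipativeExtension

/-!
On `D(A) ∔ 𝒱` one has `Im ⟨f + v, A_{𝒱,ℒ} (f + v)⟩ = ⟨f, S f⟩ + Re ⟨u, S f⟩ + c` with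
`u = ℒ v + v` and `c = Re ⟨v, S_F ℒ v⟩`. Since `⟨f, S f⟩ = ‖S_K^{1/2} f‖²` and
`⟨u, S f⟩ = ⟨S_K^{1/2} u, S_K^{1/2} f⟩`, completing the square gives the infimum over `f ∈ D(S)`:
it is `c - ¼ ‖S_K^{1/2} u‖²` if `u ∈ D(S_K^{1/2})`, and `-∞` otherwise. That the infimum is not
larger is an extremal property of `S_K`: every vector `S_K^{1/2} z` in the range of `S_K^{1/2}` is
orthogonal to `ker S*`, hence of the form `S̄ g`, with `⟨g, S̄ g⟩ ≤ ‖z‖²`. Every dissipative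
extension of `A` has the form `A_{𝒱,ℒ}` because `S_F` is surjective.
-/

noncomputable section

open Filter Topology Complex
open scoped InnerProductSpace

namespace DissipativeExtension

section Graph

variable {R E F : Type*} [Ring R] [AddCommGroup E] [Module R E] [AddCommGroup F] [Module R F]

theorem mem_domRestrict_graph_iff {T : E →ₗ.[R] F} {D : Submodule R E} {x : E} {y : F} :
    (x, y) ∈ (T.domRestrict D).graph ↔ x ∈ D ∧ (x, y) ∈ T.graph := by
  constructor
  · intro h
    exact ⟨(LinearPMap.mem_domain_of_mem_graph h).1,
      LinearPMap.le_graph_of_le LinearPMap.domRestrict_le h⟩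
  · rintro ⟨hx, h⟩
    obtain ⟨x, rfl, rfl⟩ := T.mem_graph_iff.1 h
    exact (T.domRestrict D).mem_graph_iff.2
      ⟨⟨x, hx, x.2⟩, rfl, LinearPMap.domRestrict_apply rfl⟩

theorem smul_le_smul_iff {K : Type*} [DivisionRing K] [Module K F] [SMulCommClass R K F]
    {T T' : E →ₗ.[R] F} {c : K} (hc : c ≠ 0) : c • T ≤ c • T' ↔ T ≤ T' :=
  ⟨fun h => ⟨h.1, fun _ _ hxy => smul_right_injective F hc (h.2 hxy)⟩,
    fun h => ⟨h.1, fun _ _ hxy => congrArg (c • ·) (h.2 hxy)⟩⟩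

theorem closure_graph_induction {𝕜 X Y : Type*} [CommRing 𝕜] [TopologicalSpace 𝕜]
    [AddCommGroup X] [Module 𝕜 X] [TopologicalSpace X] [ContinuousAdd X] [ContinuousSMul 𝕜 X]
    [AddCommGroup Y] [Module 𝕜 Y] [TopologicalSpace Y] [ContinuousAdd Y] [ContinuousSMul 𝕜 Y]
    {T : X →ₗ.[𝕜] Y} (hT : T.IsClosable) {p : X × Y → Prop} (hp : IsClosed {z | p z})
    (h : ∀ x : T.domain, p (x, T x)) {z : X × Y} (hz : z ∈ T.closure.graph) : p z := by
  rw [← hT.graph_closure_eq_closure_graph] at hz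
  refine closure_minimal (t := {z | p z}) ?_ hp hz
  rintro z hz
  obtain ⟨x, rfl⟩ := T.mem_graph_iff'.1 hz
  exact h x

theorem isClosed_map_of_norm_le {𝕜 X Y : Type*} [NormedField 𝕜] [NormedAddCommGroup X]
    [NormedSpace 𝕜 X] [CompleteSpace X] [NormedAddCommGroup Y] [NormedSpace 𝕜 Y]
    {G : Submodule 𝕜 X} (hG : IsClosed (G : Set X)) (l : X →L[𝕜] Y) (K : NNReal)
    (hl : ∀ x ∈ G, ‖x‖ ≤ K * ‖l x‖) : IsClosed (G.map (l : X →ₗ[𝕜] Y) : Set Y) := by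
  have : CompleteSpace G := hG.completeSpace_coe
  have h := ((l.comp G.subtypeL).antilipschitz_of_bound (K := K) fun x => hl x x.2).isClosed_range
    (l.comp G.subtypeL).uniformContinuous
  convert h using 1
  ext y
  simp

end Graph

section Adjoint

variable {𝕜 E F : Type*} [RCLike 𝕜] [NormedAddCommGroup E] [InnerProductSpace 𝕜 E]
  [CompleteSpace E] [NormedAddCommGroup F] [InnerProductSpace 𝕜 F]

theorem mem_adjoint_graph_iff {T : E →ₗ.[𝕜] F} (hT : Dense (T.domain : Set E)) {y : F} {z : E} :
    (y, z) ∈ T.adjoint.graph ↔ ∀ x x', (x, x') ∈ T.graph → ⟪x', y⟫_𝕜 = ⟪x, z⟫_𝕜 := by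
  simp only [LinearPMap.adjoint_graph_eq_graph_adjoint hT, Submodule.mem_adjoint_iff, sub_eq_zero]

theorem inner_eq_of_mem_closure_graph {T : E →ₗ.[𝕜] F} (hT : Dense (T.domain : Set E))
    (hcl : T.IsClosable) {x : E} {x' : F} (hx : (x, x') ∈ T.closure.graph) {y : F} {z : E}
    (hy : (y, z) ∈ T.adjoint.graph) : ⟪x', y⟫_𝕜 = ⟪x, z⟫_𝕜 :=
  closure_graph_induction hcl (p := fun q => ⟪q.2, y⟫_𝕜 = ⟪q.1, z⟫_𝕜)
    (isClosed_eq (by fun_prop) (by fun_prop))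
    (fun f => (mem_adjoint_graph_iff hT).1 hy _ _ (T.mem_graph f)) hx

theorem isClosable_of_isFormalAdjoint {T : E →ₗ.[𝕜] E} (hT : Dense (T.domain : Set E))
    (hs : T.IsFormalAdjoint T) : T.IsClosable :=
  (LinearPMap.adjoint_isClosed hT).isClosable.leIsClosable (hs.le_adjoint hT)

theorem closure_graph_le_adjoint_graph {T : E →ₗ.[𝕜] E} (hT : Dense (T.domain : Set E))
    (hs : T.IsFormalAdjoint T) : T.closure.graph ≤ T.adjoint.graph := by
  rw [← (isClosable_of_isFormalAdjoint hT hs).graph_closure_eq_closure_graph]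
  exact Submodule.topologicalClosure_minimal _ (LinearPMap.le_graph_of_le (hs.le_adjoint hT))
    (LinearPMap.adjoint_isClosed hT)

/-- The range of the closure of `T` is closed when `T` is bounded below, hence it is all of
`(ker T†)ᗮ`. -/
theorem exists_mem_closure_graph [CompleteSpace F] {T : E →ₗ.[𝕜] F}
    (hT : Dense (T.domain : Set E)) (hcl : T.IsClosable) {K : NNReal}
    (hK : ∀ x : T.domain, ‖(x : E)‖ ≤ K * ‖T x‖) {z : F}
    (hz : ∀ k, (k, 0) ∈ T.adjoint.graph → ⟪k, z⟫_𝕜 = 0) : ∃ g, (g, z) ∈ T.closure.graph := by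
  have hbound : ∀ p ∈ T.closure.graph, ‖p‖ ≤ (max K 1 : NNReal) * ‖p.2‖ := by
    intro p hp
    refine max_le ?_ (le_mul_of_one_le_left (norm_nonneg _) (le_max_right K 1))
    have hp1 : ‖p.1‖ ≤ K * ‖p.2‖ :=
      closure_graph_induction hcl (p := fun q => ‖q.1‖ ≤ K * ‖q.2‖)
        (isClosed_le (by fun_prop) (by fun_prop)) hK hp
    exact hp1.trans (mul_le_mul_of_nonneg_right (le_max_left K 1) (norm_nonneg _))
  let M := T.closure.graph.map (ContinuousLinearMap.snd 𝕜 E F : E × F →ₗ[𝕜] F)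
  have hM : IsClosed (M : Set F) := isClosed_map_of_norm_le hcl.closure_isClosed _ _ hbound
  have : CompleteSpace M := hM.completeSpace_coe
  have hzM : z ∈ M := by
    rw [← Submodule.orthogonal_orthogonal M, Submodule.mem_orthogonal]
    intro k hk
    refine hz k ((mem_adjoint_graph_iff hT).2 fun x x' hx => ?_)
    rw [inner_zero_right]
    exact hk _ (Submodule.mem_map_of_mem (LinearPMap.le_graph_of_le T.le_closure hx))
  obtain ⟨⟨g, _⟩, hg, rfl⟩ := hzM
  exact ⟨g, hg⟩

theorem isSelfAdjoint_of_mem_graph_iff {T : E →ₗ.[𝕜] E} (hT : Dense (T.domain : Set E))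
    (h : ∀ y z, (y, z) ∈ T.graph ↔ ∀ x x', (x, x') ∈ T.graph → ⟪x', y⟫_𝕜 = ⟪x, z⟫_𝕜) :
    IsSelfAdjoint T := by
  refine LinearPMap.isSelfAdjoint_def.2 (LinearPMap.eq_of_eq_graph ?_)
  ext ⟨y, z⟩
  rw [mem_adjoint_graph_iff hT, h]

theorem mem_graph_iff_of_isSelfAdjoint {T : E →ₗ.[𝕜] E} (hT : IsSelfAdjoint T) {y z : E} :
    (y, z) ∈ T.graph ↔ ∀ x x', (x, x') ∈ T.graph → ⟪x', y⟫_𝕜 = ⟪x, z⟫_𝕜 := by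
  rw [← mem_adjoint_graph_iff hT.dense_domain, LinearPMap.isSelfAdjoint_def.1 hT]

theorem inner_eq_of_isSelfAdjoint {T : E →ₗ.[𝕜] E} (hT : IsSelfAdjoint T) {x x' y y' : E}
    (hx : (x, x') ∈ T.graph) (hy : (y, y') ∈ T.graph) : ⟪x', y⟫_𝕜 = ⟪x, y'⟫_𝕜 :=
  (mem_graph_iff_of_isSelfAdjoint hT).1 hy x x' hx

theorem exists_mem_graph_of_norm_inner_le {T : E →ₗ.[𝕜] E} (hT : IsSelfAdjoint T) {u : E} {K : ℝ}
    (hK : 0 ≤ K) (hu : ∀ x y, (x, y) ∈ T.graph → ‖⟪u, y⟫_𝕜‖ ≤ K * ‖x‖) :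
    ∃ w, (u, w) ∈ T.graph ∧ ‖w‖ ≤ K := by
  have hmem : u ∈ T.domain := by
    rw [← LinearPMap.isSelfAdjoint_def.1 hT, LinearPMap.mem_adjoint_domain_iff]
    exact AddMonoidHomClass.continuous_of_bound ((innerₛₗ 𝕜 u).comp T.toFun) K
      fun x => hu x (T x) (T.mem_graph x)
  obtain ⟨w, hw⟩ := LinearPMap.mem_domain_iff.1 hmem
  have hbound : ∀ x, ‖⟪w, x⟫_𝕜‖ ≤ K * ‖x‖ := by
    refine hT.dense_domain.induction (fun x hx => ?_) (isClosed_le (by fun_prop) (by fun_prop))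
    rw [inner_eq_of_isSelfAdjoint hT hw (T.mem_graph ⟨x, hx⟩)]
    exact hu x _ (T.mem_graph ⟨x, hx⟩)
  refine ⟨w, hw, ?_⟩
  rw [← innerSL_apply_norm (𝕜 := 𝕜) w]
  exact ContinuousLinearMap.opNorm_le_bound _ hK hbound

end Adjoint

section Resolvent

variable {𝕜 E : Type*} [RCLike 𝕜] [NormedAddCommGroup E] [InnerProductSpace 𝕜 E]

theorem norm_le_norm_add_of_re_inner_nonneg {x y : E} (h : 0 ≤ RCLike.re ⟪x, y⟫_𝕜) :
    ‖x‖ ≤ ‖x + y‖ := by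
  rw [← sq_le_sq₀ (norm_nonneg _) (norm_nonneg _), @norm_add_sq 𝕜]
  linarith [sq_nonneg ‖y‖]

theorem re_inner_nonneg_of_mem_graph {T : E →ₗ.[𝕜] E}
    (hpos : ∀ x : T.domain, 0 ≤ RCLike.re ⟪(x : E), T x⟫_𝕜) {x y : E} (h : (x, y) ∈ T.graph) :
    0 ≤ RCLike.re ⟪x, y⟫_𝕜 := by
  obtain ⟨x, rfl, rfl⟩ := T.mem_graph_iff.1 h
  exact hpos x

variable [CompleteSpace E] {T : E →ₗ.[𝕜] E} (hT : IsSelfAdjoint T)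
  (hpos : ∀ x : T.domain, 0 ≤ RCLike.re ⟪(x : E), T x⟫_𝕜)

include hT hpos

theorem exists_mem_graph_add_eq (h : E) : ∃ x y, (x, y) ∈ T.graph ∧ x + y = h := by
  let l : E × E →L[𝕜] E := ContinuousLinearMap.fst 𝕜 E E + ContinuousLinearMap.snd 𝕜 E E
  have hbound : ∀ p ∈ T.graph, ‖p‖ ≤ (1 : NNReal) * ‖l p‖ := by
    rintro ⟨x, y⟩ hp
    have hxy := re_inner_nonneg_of_mem_graph hpos hp
    rw [NNReal.coe_one, one_mul]
    refine max_le (norm_le_norm_add_of_re_inner_nonneg hxy) ?_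
    rw [inner_re_symm] at hxy
    exact (norm_le_norm_add_of_re_inner_nonneg hxy).trans_eq (by rw [add_comm]; rfl)
  have hclosed := isClosed_map_of_norm_le hT.isClosed l 1 hbound
  have : CompleteSpace (T.graph.map (l : E × E →ₗ[𝕜] E)) := hclosed.completeSpace_coe
  have hrange : T.graph.map (l : E × E →ₗ[𝕜] E) = ⊤ := by
    rw [← Submodule.orthogonal_eq_bot_iff, Submodule.eq_bot_iff]
    intro z hz
    have hmem : (z, -z) ∈ T.graph := by
      refine (mem_graph_iff_of_isSelfAdjoint hT).2 fun x x' hx => ?_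
      have : ⟪x + x', z⟫_𝕜 = 0 := hz _ (Submodule.mem_map_of_mem hx)
      rw [inner_add_left] at this
      rw [inner_neg_right, eq_neg_of_add_eq_zero_right this]
    have hneg := re_inner_nonneg_of_mem_graph hpos hmem
    rw [inner_neg_right, map_neg, Left.nonneg_neg_iff] at hneg
    exact re_inner_self_nonpos.1 hneg
  obtain ⟨⟨x, y⟩, hxy, hsum⟩ := hrange ▸ Submodule.mem_top (x := h)
  exact ⟨x, y, hxy, hsum⟩

theorem exists_resolvent :
    ∃ B : E →L[𝕜] E, ∀ x y, (x, y) ∈ T.graph ↔ B (x + y) = x := by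
  let l : T.graph →ₗ[𝕜] E := (LinearMap.fst 𝕜 E E + LinearMap.snd 𝕜 E E) ∘ₗ T.graph.subtype
  have hnorm : ∀ p : T.graph, ‖p.1.1‖ ≤ ‖l p‖ := fun p =>
    norm_le_norm_add_of_re_inner_nonneg (re_inner_nonneg_of_mem_graph hpos p.2)
  have hinj : Function.Injective l := by
    refine (injective_iff_map_eq_zero l).2 fun p hp => ?_
    have hfst : p.1.1 = 0 := norm_le_zero_iff.1 ((hnorm p).trans_eq (by rw [hp, norm_zero]))
    exact Subtype.ext (Prod.ext hfst (T.graph_fst_eq_zero_snd p.2 hfst))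
  have hsurj : Function.Surjective l := fun h =>
    let ⟨x, y, hxy, hsum⟩ := exists_mem_graph_add_eq hT hpos h
    ⟨⟨(x, y), hxy⟩, hsum⟩
  let e := LinearEquiv.ofBijective l ⟨hinj, hsurj⟩
  have he : ∀ h, (e.symm h).1.1 + (e.symm h).1.2 = h := e.apply_symm_apply
  let B : E →L[𝕜] E := LinearMap.mkContinuous
    (LinearMap.fst 𝕜 E E ∘ₗ T.graph.subtype ∘ₗ (e.symm : E →ₗ[𝕜] T.graph)) 1 fun h => by
      simpa using (hnorm (e.symm h)).trans_eq (congrArg norm (he h))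
  refine ⟨B, fun x y => ⟨fun hxy => ?_, fun hxy => ?_⟩⟩
  · exact congrArg (fun p => p.1.1) (e.symm_apply_apply ⟨(x, y), hxy⟩)
  · have hy := he (x + y)
    have hx : (e.symm (x + y)).1.1 = x := hxy
    rw [hx, add_right_inj] at hy
    have hmem := (e.symm (x + y)).2
    rwa [← Prod.mk.eta (p := (e.symm (x + y)).1), hx, hy] at hmem

variable {B : E →L[𝕜] E} (hB : ∀ x y, (x, y) ∈ T.graph ↔ B (x + y) = x)

include hB

theorem isPositive_resolvent : B.IsPositive := by
  have hmem : ∀ h, (B h, h - B h) ∈ T.graph := fun h => (hB _ _).2 (by rw [add_sub_cancel])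
  refine ⟨fun x y => ?_, fun x => ?_⟩
  · have := inner_eq_of_isSelfAdjoint hT (hmem x) (hmem y)
    rw [inner_sub_left, inner_sub_right] at this
    exact (sub_left_inj.1 this).symm
  · have hx : ⟪B x, x⟫_𝕜 = ⟪B x, B x⟫_𝕜 + ⟪B x, x - B x⟫_𝕜 := by
      rw [← inner_add_right, add_sub_cancel]
    rw [ContinuousLinearMap.reApplyInnerSelf_apply, hx, map_add]
    exact add_nonneg inner_self_nonneg (re_inner_nonneg_of_mem_graph hpos (hmem x))

theorem isPositive_one_sub_resolvent : (1 - B).IsPositive := by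
  have hmem : ∀ h, (B h, h - B h) ∈ T.graph := fun h => (hB _ _).2 (by rw [add_sub_cancel])
  refine ⟨ContinuousLinearMap.isPositive_one.isSymmetric.sub
    (isPositive_resolvent hT hpos hB).isSymmetric, fun x => ?_⟩
  have hx : ⟪x - B x, x⟫_𝕜 = ⟪x - B x, B x⟫_𝕜 + ⟪x - B x, x - B x⟫_𝕜 := by
    rw [← inner_add_right, add_sub_cancel]
  change 0 ≤ RCLike.re ⟪x - B x, x⟫_𝕜
  rw [hx, map_add, inner_re_symm]
  exact add_nonneg (re_inner_nonneg_of_mem_graph hpos (hmem x)) inner_self_nonneg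

end Resolvent

section SquareRoot

variable {H : Type*} [NormedAddCommGroup H] [InnerProductSpace ℂ H]

/-- The operator `a t ↦ b t` with domain the range of `a`, for `a` injective. -/
def tangent (a b : H →L[ℂ] H) : H →ₗ.[ℂ] H :=
  (LinearMap.range ((a : H →ₗ[ℂ] H).prod (b : H →ₗ[ℂ] H))).toLinearPMap

/-- The cosine `a` and sine `b` of an operator angle in `[0, π / 2)`. A non-negative selfadjoint
operator `R` is `tangent a b` for `a = (1 + R²)^{-1/2}` and `b = R (1 + R²)^{-1/2}`. -/
structure IsCosSinPair (a b : H →L[ℂ] H) : Prop where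
  cos_isPositive : a.IsPositive
  sin_isPositive : b.IsPositive
  commute : Commute a b
  sq_add_sq : a * a + b * b = 1
  injective : Function.Injective a

namespace IsCosSinPair

variable {a b : H →L[ℂ] H} (h : IsCosSinPair a b)

include h

theorem sin_cos_apply (x : H) : b (a x) = a (b x) :=
  DFunLike.congr_fun h.commute.eq.symm x

theorem sq_add_sq_apply (x : H) : a (a x) + b (b x) = x :=
  DFunLike.congr_fun h.sq_add_sq x

theorem mem_tangent_graph_iff_exists {x y : H} :
    (x, y) ∈ (tangent a b).graph ↔ ∃ t, a t = x ∧ b t = y := by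
  rw [tangent, Submodule.toLinearPMap_graph_eq]
  · simp
  · rintro _ ⟨t, rfl⟩ (ht : a t = 0)
    rw [(map_eq_zero_iff a h.injective).1 ht, map_zero, Prod.snd_zero]

theorem mem_tangent_graph_iff {x y : H} : (x, y) ∈ (tangent a b).graph ↔ b x = a y := by
  rw [h.mem_tangent_graph_iff_exists]
  constructor
  · rintro ⟨t, rfl, rfl⟩
    exact h.sin_cos_apply t
  · intro hxy
    refine ⟨a x + b y, ?_, ?_⟩
    · rw [map_add, ← h.sin_cos_apply, ← hxy, h.sq_add_sq_apply]
    · rw [map_add, h.sin_cos_apply, hxy, h.sq_add_sq_apply]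

variable [CompleteSpace H]

theorem dense_tangent_domain : Dense ((tangent a b).domain : Set H) := by
  rw [Submodule.dense_iff_topologicalClosure_eq_top, Submodule.topologicalClosure_eq_top_iff,
    Submodule.eq_bot_iff]
  intro z hz
  have hmem : a (a z) ∈ (tangent a b).domain :=
    LinearPMap.mem_domain_of_mem_graph (h.mem_tangent_graph_iff_exists.2 ⟨a z, rfl, rfl⟩)
  have hinner : ⟪a (a z), z⟫_ℂ = 0 := hz _ hmem
  rw [h.cos_isPositive.inner_left_eq_inner_right] at hinner
  exact (map_eq_zero_iff a h.injective).1 (inner_self_eq_zero.1 hinner)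

theorem isSelfAdjoint_tangent : IsSelfAdjoint (tangent a b) := by
  refine isSelfAdjoint_of_mem_graph_iff h.dense_tangent_domain fun y z => ?_
  simp only [h.mem_tangent_graph_iff (x := y), h.mem_tangent_graph_iff_exists, forall_exists_index,
    and_imp]
  constructor
  · rintro hyz _ _ t rfl rfl
    rw [h.sin_isPositive.inner_left_eq_inner_right, hyz,
      h.cos_isPositive.inner_left_eq_inner_right]
  · intro hyz
    refine ext_inner_left ℂ fun t => ?_
    rw [← h.sin_isPositive.inner_left_eq_inner_right,
      ← h.cos_isPositive.inner_left_eq_inner_right]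
    exact hyz _ _ t rfl rfl

theorem re_inner_tangent_nonneg (x : (tangent a b).domain) :
    0 ≤ (⟪(x : H), tangent a b x⟫_ℂ).re := by
  obtain ⟨t, ht, ht'⟩ := h.mem_tangent_graph_iff_exists.1 ((tangent a b).mem_graph x)
  have hab : (a * b).IsPositive := (ContinuousLinearMap.nonneg_iff_isPositive _).1 <|
    h.commute.mul_nonneg ((ContinuousLinearMap.nonneg_iff_isPositive a).2 h.cos_isPositive)
      ((ContinuousLinearMap.nonneg_iff_isPositive b).2 h.sin_isPositive)
  rw [← ht, ← ht', h.cos_isPositive.inner_left_eq_inner_right]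
  exact hab.re_inner_nonneg_right t

theorem isNonnegSqrt_tangent {T : H →ₗ.[ℂ] H}
    (hT : ∀ x y, (x, y) ∈ T.graph ↔ a (a (x + y)) = x) : IsNonnegSqrt T (tangent a b) := by
  refine ⟨h.isSelfAdjoint_tangent, h.re_inner_tangent_nonneg, fun x y => ?_⟩
  simp only [hT, h.mem_tangent_graph_iff]
  constructor
  · intro hxy
    have hy : b (b (x + y)) = y := by
      simpa only [hxy, add_right_inj] using h.sq_add_sq_apply (x + y)
    refine ⟨a (b (x + y)), ?_, ?_⟩
    · rw [← h.sin_cos_apply, ← h.sin_cos_apply, hxy]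
    · rw [h.sin_cos_apply, hy]
  · rintro ⟨z, hxz, hzy⟩
    rw [map_add, map_add, ← hzy, ← h.sin_cos_apply, ← hxz, h.sq_add_sq_apply]

end IsCosSinPair

variable [CompleteSpace H]

theorem exists_isNonnegSqrt {T : H →ₗ.[ℂ] H} (hT : IsSelfAdjoint T)
    (hpos : ∀ x : T.domain, 0 ≤ (⟪(x : H), T x⟫_ℂ).re) : ∃ R, IsNonnegSqrt T R := by
  obtain ⟨B, hB⟩ := exists_resolvent hT hpos
  have hB0 : 0 ≤ B := (ContinuousLinearMap.nonneg_iff_isPositive B).2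
    (isPositive_resolvent hT hpos hB)
  have hB1 : 0 ≤ 1 - B := (ContinuousLinearMap.nonneg_iff_isPositive _).2
    (isPositive_one_sub_resolvent hT hpos hB)
  have hcos (x : H) : CFC.sqrt B (CFC.sqrt B x) = B x :=
    DFunLike.congr_fun (CFC.sqrt_mul_sqrt_self B) x
  have hcomm : Commute B (1 - B) := (Commute.one_right B).sub_right (Commute.refl B)
  have hpair : IsCosSinPair (CFC.sqrt B) (CFC.sqrt (1 - B)) :=
    { cos_isPositive := (ContinuousLinearMap.nonneg_iff_isPositive _).1 (CFC.sqrt_nonneg _)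
      sin_isPositive := (ContinuousLinearMap.nonneg_iff_isPositive _).1 (CFC.sqrt_nonneg _)
      commute := ((hcomm.cfcₙ_nnreal _).symm.cfcₙ_nnreal _).symm
      sq_add_sq := by
        rw [CFC.sqrt_mul_sqrt_self B, CFC.sqrt_mul_sqrt_self (1 - B), add_sub_cancel]
      injective := (injective_iff_map_eq_zero _).2 fun x hx => by
        have hmem : (0, x) ∈ T.graph := by rw [hB, zero_add, ← hcos, hx, map_zero]
        exact T.graph_fst_eq_zero_snd hmem rfl }
  exact ⟨_, hpair.isNonnegSqrt_tangent fun x y => by rw [hcos, hB]⟩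

end SquareRoot

section Krein

variable {H : Type*} [NormedAddCommGroup H] [InnerProductSpace ℂ H]
  {S : H →ₗ.[ℂ] H}

theorem mem_kernel_iff {T : H →ₗ.[ℂ] H} {k : H} : k ∈ kernel T ↔ (k, 0) ∈ T.graph := by
  simp [kernel, LinearPMap.mem_graph_iff]

variable [CompleteSpace H]

theorem mem_krein_graph_iff (hd : Dense (S.domain : Set H)) (hs : S.IsFormalAdjoint S) {x y : H} :
    (x, y) ∈ (krein S).graph ↔
      ∃ g k, (g, y) ∈ S.closure.graph ∧ (k, 0) ∈ S.adjoint.graph ∧ g + k = x := by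
  have hle := closure_graph_le_adjoint_graph hd hs
  rw [krein, mem_domRestrict_graph_iff, Submodule.mem_sup]
  constructor
  · rintro ⟨⟨g, hg, k, hk, rfl⟩, h⟩
    obtain ⟨z, hz⟩ := LinearPMap.mem_domain_iff.1 hg
    rw [mem_kernel_iff] at hk
    have hadd := S.adjoint.graph.add_mem (hle hz) hk
    rw [Prod.mk_add_mk, add_zero] at hadd
    exact ⟨g, k, S.adjoint.mem_graph_snd_inj hadd h rfl ▸ hz, hk, rfl⟩
  · rintro ⟨g, k, hg, hk, rfl⟩
    refine ⟨⟨g, LinearPMap.mem_domain_of_mem_graph hg, k, mem_kernel_iff.2 hk, rfl⟩, ?_⟩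
    simpa using S.adjoint.graph.add_mem (hle hg) hk

theorem le_krein (hd : Dense (S.domain : Set H)) (hs : S.IsFormalAdjoint S) : S ≤ krein S := by
  refine LinearPMap.le_of_le_graph ?_
  rintro ⟨x, y⟩ h
  exact (mem_krein_graph_iff hd hs).2
    ⟨x, 0, LinearPMap.le_graph_of_le S.le_closure h, Submodule.zero_mem _, add_zero _⟩

theorem inner_eq_zero_of_mem_adjoint_kernel (hd : Dense (S.domain : Set H)) (hcl : S.IsClosable)
    {g z k : H} (hg : (g, z) ∈ S.closure.graph) (hk : (k, 0) ∈ S.adjoint.graph) :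
    ⟪k, z⟫_ℂ = 0 := by
  rw [inner_eq_zero_symm, inner_eq_of_mem_closure_graph hd hcl hg hk, inner_zero_right]

theorem re_inner_krein_nonneg (hd : Dense (S.domain : Set H)) (hs : S.IsFormalAdjoint S)
    (hpos : ∀ f, 0 ≤ quadForm S f) (x : (krein S).domain) : 0 ≤ (⟪(x : H), krein S x⟫_ℂ).re := by
  have hcl := isClosable_of_isFormalAdjoint hd hs
  obtain ⟨g, k, hg, hk, hx⟩ := (mem_krein_graph_iff hd hs).1 ((krein S).mem_graph x)
  rw [← hx, inner_add_left, inner_eq_zero_of_mem_adjoint_kernel hd hcl hg hk, add_zero]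
  exact closure_graph_induction hcl (p := fun q => 0 ≤ (⟪q.1, q.2⟫_ℂ).re)
    (isClosed_le continuous_const (Complex.continuous_re.comp (by fun_prop))) hpos hg

end Krein

namespace IsStrictlyPositiveSymmetric

variable {H : Type*} [NormedAddCommGroup H] [InnerProductSpace ℂ H] {S : H →ₗ.[ℂ] H}
  (hS : IsStrictlyPositiveSymmetric S)

include hS

theorem exists_norm_sq_le_mul_quadForm :
    ∃ K : NNReal, ∀ f : S.domain, ‖(f : H)‖ ^ 2 ≤ K * quadForm S f := by
  obtain ⟨ε, hε, hpos⟩ := hS.strictly_positive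
  refine ⟨⟨ε⁻¹, (inv_pos.2 hε).le⟩, fun f => ?_⟩
  exact (le_inv_mul_iff₀ hε).2 (hpos f)

theorem exists_norm_le_mul_norm_apply :
    ∃ K : NNReal, ∀ f : S.domain, ‖(f : H)‖ ≤ K * ‖S f‖ := by
  obtain ⟨K, hK⟩ := hS.exists_norm_sq_le_mul_quadForm
  refine ⟨K, fun f => ?_⟩
  rcases (norm_nonneg (f : H)).eq_or_lt with hf | hf
  · rw [← hf]
    positivity
  · refine le_of_mul_le_mul_left ?_ hf
    calc ‖(f : H)‖ * ‖(f : H)‖ ≤ K * quadForm S f := by rw [← sq]; exact hK f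
      _ ≤ K * (‖(f : H)‖ * ‖S f‖) := by gcongr; exact re_inner_le_norm (𝕜 := ℂ) _ _
      _ = ‖(f : H)‖ * (K * ‖S f‖) := by ring

variable [CompleteSpace H]

theorem isClosable : S.IsClosable :=
  isClosable_of_isFormalAdjoint hS.dense hS.symmetric

theorem exists_mem_closure_graph_of_inner_kernel_eq_zero {z : H}
    (hz : ∀ k, (k, 0) ∈ S.adjoint.graph → ⟪k, z⟫_ℂ = 0) : ∃ g, (g, z) ∈ S.closure.graph :=
  let ⟨_, hK⟩ := hS.exists_norm_le_mul_norm_apply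
  exists_mem_closure_graph hS.dense hS.isClosable hK hz

theorem isSelfAdjoint_krein : IsSelfAdjoint (krein S) := by
  have hgraph {x y : H} := mem_krein_graph_iff hS.dense hS.symmetric (x := x) (y := y)
  have hle := closure_graph_le_adjoint_graph hS.dense hS.symmetric
  have hSK := le_krein hS.dense hS.symmetric
  refine isSelfAdjoint_of_mem_graph_iff (hS.dense.mono hSK.1) fun y z => ⟨?_, fun h => ?_⟩
  · intro hy x x' hx
    obtain ⟨g, k, hg, hk, rfl⟩ := hgraph.1 hx
    obtain ⟨g', k', hg', hk', rfl⟩ := hgraph.1 hy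
    rw [inner_add_left, inner_add_right,
      inner_eq_of_mem_closure_graph hS.dense hS.isClosable hg (hle hg'),
      inner_eq_of_mem_closure_graph hS.dense hS.isClosable hg hk', inner_zero_right,
      inner_eq_zero_of_mem_adjoint_kernel hS.dense hS.isClosable hg' hk]
  · have hyz : (y, z) ∈ S.adjoint.graph :=
      (mem_adjoint_graph_iff hS.dense).2 fun x x' hx => h x x' (LinearPMap.le_graph_of_le hSK hx)
    obtain ⟨g, hg⟩ : ∃ g, (g, z) ∈ S.closure.graph := by
      refine hS.exists_mem_closure_graph_of_inner_kernel_eq_zero fun k hk => ?_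
      rw [← h k 0 (hgraph.2 ⟨0, k, Submodule.zero_mem _, hk, zero_add k⟩), inner_zero_left]
    refine hgraph.2 ⟨g, y - g, hg, ?_, add_sub_cancel g y⟩
    simpa using S.adjoint.graph.sub_mem hyz (hle hg)

theorem isNonnegSqrt_sqrt_krein : IsNonnegSqrt (krein S) (sqrt (krein S)) := by
  have h := exists_isNonnegSqrt hS.isSelfAdjoint_krein
    (re_inner_krein_nonneg hS.dense hS.symmetric hS.quadForm_nonneg)
  rw [sqrt, dif_pos h]
  exact h.choose_spec

end IsStrictlyPositiveSymmetric

section Variational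

variable {H : Type*} [NormedAddCommGroup H] [InnerProductSpace ℂ H] {S R : H →ₗ.[ℂ] H}

theorem norm_inner_sq_le_of_forall_nonneg {u : H} {c : ℝ}
    (h : ∀ f, 0 ≤ quadForm S f + (⟪u, S f⟫_ℂ).re + c) (f : S.domain) :
    ‖⟪u, S f⟫_ℂ‖ ^ 2 ≤ 4 * c * quadForm S f := by
  obtain ⟨θ, hθ, hphase⟩ := RCLike.exists_norm_eq_mul_self ⟪u, S f⟫_ℂ
  have hquad (t : ℝ) : 0 ≤ quadForm S f * (t * t) + ‖⟪u, S f⟫_ℂ‖ * t + c := by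
    have hf := h (((t : ℂ) * θ) • f)
    rw [quadForm_smul, LinearPMap.map_smul, inner_smul_right, mul_assoc, ← hphase, norm_mul, hθ,
      mul_one, Complex.norm_real, Real.norm_eq_abs, sq_abs, Complex.re_ofReal_mul] at hf
    simpa [sq, mul_comm] using hf
  have hdiscrim := discrim_le_zero hquad
  rw [discrim] at hdiscrim
  linarith

variable [CompleteSpace H]

namespace IsNonnegSqrt

variable {T : H →ₗ.[ℂ] H} (hR : IsNonnegSqrt T R)

include hR

theorem norm_sq_eq {x y z : H} (hxz : (x, z) ∈ R.graph) (hzy : (z, y) ∈ R.graph) :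
    ‖z‖ ^ 2 = (⟪x, y⟫_ℂ).re := by
  rw [← inner_eq_of_isSelfAdjoint hR.selfAdjoint hxz hzy]
  exact (inner_self_eq_norm_sq (𝕜 := ℂ) z).symm

theorem mem_graph_zero {k : H} (hk : (k, 0) ∈ T.graph) : (k, 0) ∈ R.graph := by
  obtain ⟨z, hkz, hz⟩ := (hR.sq_eq k 0).1 hk
  have hz0 : z = 0 := by
    simpa only [inner_zero_right, Complex.zero_re, sq_eq_zero_iff, norm_eq_zero]
      using hR.norm_sq_eq hkz hz
  rwa [hz0] at hkz

end IsNonnegSqrt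

variable (hS : IsStrictlyPositiveSymmetric S) (hR : IsNonnegSqrt (krein S) R)

include hS hR

theorem exists_mem_closure_graph_re_inner_le {z y : H} (hzy : (z, y) ∈ R.graph) :
    ∃ g, (g, y) ∈ S.closure.graph ∧ (⟪g, y⟫_ℂ).re ≤ ‖z‖ ^ 2 := by
  have hgraph {x y : H} := mem_krein_graph_iff hS.dense hS.symmetric (x := x) (y := y)
  obtain ⟨g, hg⟩ : ∃ g, (g, y) ∈ S.closure.graph := by
    refine hS.exists_mem_closure_graph_of_inner_kernel_eq_zero fun k hk => ?_
    have hk0 := hR.mem_graph_zero (hgraph.2 ⟨0, k, Submodule.zero_mem _, hk, zero_add k⟩)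
    rw [← inner_eq_of_isSelfAdjoint hR.selfAdjoint hk0 hzy, inner_zero_left]
  obtain ⟨p, hgp, hpy⟩ :=
    (hR.sq_eq g y).1 (hgraph.2 ⟨g, 0, hg, Submodule.zero_mem _, add_zero g⟩)
  have hker : (z - p, 0) ∈ R.graph := by simpa using R.graph.sub_mem hzy hpy
  have hort : ⟪p, z - p⟫_ℂ = 0 := by
    rw [inner_eq_of_isSelfAdjoint hR.selfAdjoint hgp hker, inner_zero_right]
  refine ⟨g, hg, ?_⟩
  rw [← hR.norm_sq_eq hgp hpy]
  gcongr
  simpa using norm_le_norm_add_of_re_inner_nonneg (𝕜 := ℂ) (x := p) (y := z - p) (by simp [hort])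

theorem exists_mem_graph_of_norm_inner_sq_le {u : H} {C : ℝ} (hC : 0 ≤ C)
    (hu : ∀ f, ‖⟪u, S f⟫_ℂ‖ ^ 2 ≤ C * quadForm S f) : ∃ w, (u, w) ∈ R.graph ∧ ‖w‖ ^ 2 ≤ C := by
  have hbound : ∀ z y, (z, y) ∈ R.graph → ‖⟪u, y⟫_ℂ‖ ≤ √C * ‖z‖ := by
    intro z y hzy
    obtain ⟨g, hg, hgz⟩ := exists_mem_closure_graph_re_inner_le hS hR hzy
    have hle : ‖⟪u, y⟫_ℂ‖ ^ 2 ≤ C * (⟪g, y⟫_ℂ).re :=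
      closure_graph_induction hS.isClosable
        (p := fun q => ‖⟪u, q.2⟫_ℂ‖ ^ 2 ≤ C * (⟪q.1, q.2⟫_ℂ).re)
        (isClosed_le (by fun_prop)
          (continuous_const.mul (Complex.continuous_re.comp (by fun_prop)))) hu hg
    rw [← sq_le_sq₀ (norm_nonneg _) (by positivity), mul_pow, Real.sq_sqrt hC]
    exact hle.trans (mul_le_mul_of_nonneg_left hgz hC)
  obtain ⟨w, hw, hwC⟩ :=
    exists_mem_graph_of_norm_inner_le hR.selfAdjoint (Real.sqrt_nonneg C) hbound
  exact ⟨w, hw, (Real.le_sqrt (norm_nonneg w) hC).1 hwC⟩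

theorem forall_quadForm_add_nonneg_iff {u : H} {c : ℝ} :
    (∀ f, 0 ≤ quadForm S f + (⟪u, S f⟫_ℂ).re + c) ↔
      ∃ h : u ∈ R.domain, 1 / 4 * ‖R ⟨u, h⟩‖ ^ 2 ≤ c := by
  constructor
  · intro h
    have hc : 0 ≤ c := by simpa [quadForm] using h 0
    obtain ⟨w, hw, hwc⟩ := exists_mem_graph_of_norm_inner_sq_le hS hR
      (mul_nonneg zero_le_four hc) (norm_inner_sq_le_of_forall_nonneg h)
    obtain ⟨⟨u, hu⟩, rfl, rfl⟩ := R.mem_graph_iff.1 hw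
    exact ⟨hu, by linarith⟩
  · rintro ⟨hu, hc⟩ f
    obtain ⟨r, hfr, hrS⟩ := (hR.sq_eq f (S f)).1
      (LinearPMap.le_graph_of_le (le_krein hS.dense hS.symmetric) (S.mem_graph f))
    have hnorm : quadForm S f = ‖r‖ ^ 2 := (hR.norm_sq_eq hfr hrS).symm
    have hinner : -(‖R ⟨u, hu⟩‖ * ‖r‖) ≤ (⟪u, S f⟫_ℂ).re := by
      rw [← inner_eq_of_isSelfAdjoint hR.selfAdjoint (R.mem_graph ⟨u, hu⟩) hrS]
      exact neg_le_of_abs_le ((Complex.abs_re_le_norm _).trans (norm_inner_le_norm _ _))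
    nlinarith [sq_nonneg (‖R ⟨u, hu⟩‖ / 2 - ‖r‖)]

end Variational

section EnergyMap

variable {H E : Type*} [NormedAddCommGroup H] [InnerProductSpace ℂ H] [NormedAddCommGroup E]
  [InnerProductSpace ℂ E] {S : H →ₗ.[ℂ] H}

/-- A linear map `e` on `D(S)` is an energy map if it turns the form `⟨f, S g⟩` into an inner
product. The closure of its range is then a model of the energy space of `S`, the completion of
`D(S)` for the form. -/
def IsEnergyMap (S : H →ₗ.[ℂ] H) (e : S.domain →ₗ[ℂ] E) : Prop :=
  ∀ f g : S.domain, ⟪e f, e g⟫_ℂ = ⟪(f : H), S g⟫_ℂ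

namespace IsEnergyMap

variable {e : S.domain →ₗ[ℂ] E} (he : IsEnergyMap S e)

include he

theorem norm_sq_eq (f : S.domain) : ‖e f‖ ^ 2 = quadForm S f := by
  rw [quadForm, ← he f f]
  exact (inner_self_eq_norm_sq (𝕜 := ℂ) (e f)).symm

theorem cauchySeq_iff {u : ℕ → S.domain} : CauchySeq (fun n => e (u n)) ↔
    Tendsto (fun p : ℕ × ℕ => quadForm S (u p.1 - u p.2)) atTop (𝓝 0) := by
  simp only [cauchySeq_iff_tendsto_dist_atTop_0, dist_eq_norm, ← map_sub, ← he.norm_sq_eq]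
  constructor
  · intro h
    simpa only [zero_pow two_ne_zero] using h.pow 2
  · intro h
    simpa only [Real.sqrt_sq (norm_nonneg _), Real.sqrt_zero] using h.sqrt

theorem apply_mem_closedFormDomain (hS : IsStrictlyPositiveSymmetric S) (hdense : DenseRange e)
    {J : E →L[ℂ] H} (hJ : ∀ f, J (e f) = f) (ξ : E) : J ξ ∈ closedFormDomain hS := by
  obtain ⟨v, hv, hlim⟩ := mem_closure_iff_seq_limit.1 (hdense ξ)
  choose u hu using hv
  obtain rfl : (fun n => e (u n)) = v := funext hu
  refine ⟨u, ?_, he.cauchySeq_iff.1 hlim.cauchySeq⟩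
  simpa only [Function.comp_def, hJ] using (J.continuous.tendsto ξ).comp hlim

theorem inner_apply_extension (hs : S.IsFormalAdjoint S) (hdense : DenseRange e)
    {J : E →L[ℂ] H} (hJ : ∀ f, J (e f) = f) (f : S.domain) (ξ : E) :
    ⟪S f, J ξ⟫_ℂ = ⟪e f, ξ⟫_ℂ := by
  refine hdense.induction_on ξ (isClosed_eq (by fun_prop) (by fun_prop)) fun g => ?_
  rw [hJ, he, hs f g]

/-- In terms of the embedding `J` of the energy space into `H`, the inverse of the Friedrichs
extension is `J J†`. -/
theorem mem_friedrichs_graph [CompleteSpace H] [CompleteSpace E]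
    (hS : IsStrictlyPositiveSymmetric S) (hdense : DenseRange e) {J : E →L[ℂ] H}
    (hJ : ∀ f, J (e f) = f) (h : H) : (J (J.adjoint h), h) ∈ (friedrichs hS).graph := by
  refine mem_domRestrict_graph_iff.2 ⟨he.apply_mem_closedFormDomain hS hdense hJ _, ?_⟩
  rw [mem_adjoint_graph_iff hS.dense]
  intro x x' hx
  obtain ⟨f, rfl, rfl⟩ := S.mem_graph_iff.1 hx
  rw [he.inner_apply_extension hS.symmetric hdense hJ, ContinuousLinearMap.adjoint_inner_right, hJ]

theorem exists_embedding [CompleteSpace H] (hS : IsStrictlyPositiveSymmetric S)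
    (hdense : DenseRange e) : ∃ J : E →L[ℂ] H, ∀ f, J (e f) = f := by
  obtain ⟨K, hK⟩ := hS.exists_norm_sq_le_mul_quadForm
  have hbound (f : S.domain) : ‖S.domain.subtype f‖ ≤ √K * ‖e f‖ := by
    rw [← sq_le_sq₀ (norm_nonneg _) (by positivity), mul_pow,
      Real.sq_sqrt K.coe_nonneg, he.norm_sq_eq]
    exact hK f
  exact ⟨S.domain.subtype.extendOfNorm e, LinearMap.extendOfNorm_eq hdense ⟨√K, hbound⟩⟩

theorem exists_denseRange :
    ∃ e' : S.domain →ₗ[ℂ] (LinearMap.range e).topologicalClosure,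
      IsEnergyMap S e' ∧ DenseRange e' := by
  let ι := Submodule.inclusion (LinearMap.range e).le_topologicalClosure
  have hι : DenseRange ι := (denseRange_inclusion_iff subset_closure).2 subset_rfl
  exact ⟨ι ∘ₗ e.rangeRestrict, fun f g => he f g,
    hι.comp e.surjective_rangeRestrict.denseRange (continuous_inclusion subset_closure)⟩

end IsEnergyMap

variable [CompleteSpace H]

theorem IsNonnegSqrt.exists_isEnergyMap {T R : H →ₗ.[ℂ] H} (hR : IsNonnegSqrt T R) (hST : S ≤ T) :
    ∃ e : S.domain →ₗ[ℂ] H, IsEnergyMap S e ∧ ∀ f : S.domain, ((f : H), e f) ∈ R.graph := by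
  have hsqrt (f : S.domain) : ∃ r, ((f : H), r) ∈ R.graph ∧ (r, S f) ∈ R.graph :=
    (hR.sq_eq f (S f)).1 (LinearPMap.le_graph_of_le hST (S.mem_graph f))
  have hle : S.domain ≤ R.domain := fun f hf =>
    let ⟨_, hr, _⟩ := hsqrt ⟨f, hf⟩
    LinearPMap.mem_domain_of_mem_graph hr
  have hgraph (f : S.domain) : ((f : H), R (Submodule.inclusion hle f)) ∈ R.graph :=
    R.mem_graph (Submodule.inclusion hle f)
  refine ⟨R.toFun ∘ₗ Submodule.inclusion hle, fun f g => ?_, hgraph⟩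
  obtain ⟨r, hr, hrS⟩ := hsqrt g
  obtain rfl := R.mem_graph_snd_inj (hgraph g) hr rfl
  exact inner_eq_of_isSelfAdjoint hR.selfAdjoint (hgraph f) hrS

variable {hS : IsStrictlyPositiveSymmetric S}

theorem closedFormDomain_le {T R : H →ₗ.[ℂ] H} (hR : IsNonnegSqrt T R) (hST : S ≤ T) :
    closedFormDomain hS ≤ R.domain := by
  obtain ⟨e, he, hgraph⟩ := hR.exists_isEnergyMap hST
  rintro w ⟨u, hu, hcauchy⟩
  obtain ⟨ξ, hξ⟩ := cauchySeq_tendsto_of_complete (he.cauchySeq_iff.2 hcauchy)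
  have hmem : (w, ξ) ∈ R.graph := hR.selfAdjoint.isClosed.mem_of_tendsto (hu.prodMk_nhds hξ)
    (Eventually.of_forall fun n => hgraph (u n))
  exact LinearPMap.mem_domain_of_mem_graph hmem

theorem friedrichs_domain_le {T R : H →ₗ.[ℂ] H} (hR : IsNonnegSqrt T R) (hST : S ≤ T) :
    (friedrichs hS).domain ≤ R.domain :=
  inf_le_left.trans (closedFormDomain_le hR hST)

theorem friedrichs_surjective (hS : IsStrictlyPositiveSymmetric S) :
    Function.Surjective (friedrichs hS) := by
  obtain ⟨e, he, -⟩ :=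
    hS.isNonnegSqrt_sqrt_krein.exists_isEnergyMap (le_krein hS.dense hS.symmetric)
  have : CompleteSpace (LinearMap.range e).topologicalClosure :=
    (LinearMap.range e).isClosed_topologicalClosure.completeSpace_coe
  obtain ⟨e', he', hdense⟩ := he.exists_denseRange
  obtain ⟨J, hJ⟩ := he'.exists_embedding hS hdense
  exact fun h => LinearPMap.mem_range_iff.2 ⟨_, he'.mem_friedrichs_graph hS hdense hJ h⟩

end EnergyMap

section Extension

variable {H : Type*} [NormedAddCommGroup H] [InnerProductSpace ℂ H] [CompleteSpace H]
  {S : H →ₗ.[ℂ] H}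

theorem inner_friedrichs (hS : IsStrictlyPositiveSymmetric S) (f : S.domain)
    (w : (friedrichs hS).domain) : ⟪(f : H), friedrichs hS w⟫_ℂ = ⟪S f, (w : H)⟫_ℂ := by
  have hw : ((w : H), friedrichs hS w) ∈ S.adjoint.graph :=
    LinearPMap.le_graph_of_le LinearPMap.domRestrict_le ((friedrichs hS).mem_graph w)
  exact ((mem_adjoint_graph_iff hS.dense).1 hw f (S f) (S.mem_graph f)).symm

theorem im_inner_add_I_smul (hS : IsStrictlyPositiveSymmetric S) (f : S.domain) (v : H)
    (w : (friedrichs hS).domain) :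
    (⟪(f : H) + v, I • S f + I • friedrichs hS w⟫_ℂ).im =
      quadForm S f + (⟪(w : H) + v, S f⟫_ℂ).re + (⟪v, friedrichs hS w⟫_ℂ).re := by
  have hmixed : (⟪(f : H), friedrichs hS w⟫_ℂ).re = (⟪(w : H), S f⟫_ℂ).re := by
    rw [inner_friedrichs, ← inner_conj_symm, Complex.conj_re]
  rw [← smul_add, inner_smul_right, Complex.I_mul_im]
  simp only [inner_add_left, inner_add_right, Complex.add_re, hmixed, quadForm]
  ring

variable {hS : IsStrictlyPositiveSymmetric S}

namespace ExtensionData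

variable (P : ExtensionData hS)

theorem op_apply (f : S.domain) (v : P.V) (h : (f : H) + v ∈ P.op.domain) :
    P.op ⟨f + v, h⟩ = I • S f + I • friedrichs hS (P.L v) :=
  LinearPMap.sup_apply _ (f := I • S) (g := P.onV) f v ⟨f + v, h⟩ rfl

theorem smul_le_op : I • S ≤ P.op :=
  LinearPMap.left_le_sup _ _ _

theorem isDissipative_op_iff_forall :
    IsDissipative P.op ↔ ∀ (v : P.V) (f : S.domain),
      0 ≤ quadForm S f + (⟪(P.L v : H) + v, S f⟫_ℂ).re +
        (⟪(v : H), friedrichs hS (P.L v)⟫_ℂ).re := by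
  simp only [← im_inner_add_I_smul]
  constructor
  · intro h v f
    have hmem : (f : H) + v ∈ P.op.domain := Submodule.add_mem_sup f.2 v.2
    rw [← P.op_apply f v hmem]
    exact h.im_nonneg ⟨f + v, hmem⟩
  · refine fun h => ⟨hS.dense.mono P.smul_le_op.1, ?_⟩
    rintro ⟨x, hx⟩
    obtain ⟨f, hf, v, hv, rfl⟩ := Submodule.mem_sup.1 hx
    rw [P.op_apply ⟨f, hf⟩ ⟨v, hv⟩ hx]
    exact h ⟨v, hv⟩ ⟨f, hf⟩

theorem isDissipative_op_iff : IsDissipative P.op ↔ P.Condition :=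
  P.isDissipative_op_iff_forall.trans <| forall_congr' fun _ =>
    forall_quadForm_add_nonneg_iff hS hS.isNonnegSqrt_sqrt_krein

end ExtensionData

theorem exists_apply_eq_I_smul_friedrichs (hS : IsStrictlyPositiveSymmetric S) (B : H →ₗ.[ℂ] H) :
    ∃ L : B.domain →ₗ[ℂ] (friedrichs hS).domain, ∀ v, B v = I • friedrichs hS (L v) := by
  obtain ⟨J, hJ⟩ := LinearMap.exists_rightInverse_of_surjective (friedrichs hS).toFun
    (LinearMap.range_eq_top.2 (friedrichs_surjective hS))
  refine ⟨J ∘ₗ (I⁻¹ • B.toFun), fun v => ?_⟩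
  have hv : friedrichs hS (J (I⁻¹ • B v)) = I⁻¹ • B v := LinearMap.congr_fun hJ _
  exact (eq_inv_smul_iff₀ I_ne_zero).1 hv |>.symm

namespace IsDissipative

variable {B : H →ₗ.[ℂ] H} (hB : IsDissipative B) (hSB : I • S ≤ B)

include hB hSB

theorem domain_le_sqrt_krein (hS : IsStrictlyPositiveSymmetric S) :
    B.domain ≤ (sqrt (krein S)).domain := by
  have hR := hS.isNonnegSqrt_sqrt_krein
  obtain ⟨L, hL⟩ := exists_apply_eq_I_smul_friedrichs hS B
  intro v hv
  obtain ⟨hmem, -⟩ := (forall_quadForm_add_nonneg_iff hS hR (u := (L ⟨v, hv⟩ : H) + v)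
    (c := (⟪v, friedrichs hS (L ⟨v, hv⟩)⟫_ℂ).re)).1 fun f => by
      have him := hB.im_nonneg (⟨f, hSB.1 f.2⟩ + ⟨v, hv⟩)
      rw [LinearPMap.map_add, ← hSB.2 (x := f) (y := ⟨f, hSB.1 f.2⟩) rfl, hL] at him
      rw [← im_inner_add_I_smul]
      exact him
  have hLv := friedrichs_domain_le hR (le_krein hS.dense hS.symmetric) (L ⟨v, hv⟩).2
  simpa only [add_sub_cancel_left] using Submodule.sub_mem _ hmem hLv

theorem exists_eq_op (hS : IsStrictlyPositiveSymmetric S) : ∃ P : ExtensionData hS, B = P.op := by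
  obtain ⟨L, hL⟩ := exists_apply_eq_I_smul_friedrichs hS B
  obtain ⟨W, hW⟩ := Submodule.exists_isCompl S.domain
  let P : ExtensionData hS :=
    { V := W ⊓ B.domain
      V_le := inf_le_right.trans (hB.domain_le_sqrt_krein hSB hS)
      disjoint := hW.disjoint.mono_right inf_le_left
      L := L ∘ₗ Submodule.inclusion inf_le_right }
  have hle : S.domain ≤ B.domain := hSB.1
  have hdomain : P.op.domain = B.domain := by
    change S.domain ⊔ W ⊓ B.domain = B.domain
    rw [← sup_inf_assoc_of_le W hle, hW.sup_eq_top, top_inf_eq]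
  have hV : P.onV ≤ B := by
    refine ⟨inf_le_right, ?_⟩
    rintro v ⟨y, hy⟩ (rfl : (v : H) = y)
    exact (hL ⟨v, hy⟩).symm
  exact ⟨P, (LinearPMap.eq_of_le_of_domain_eq (LinearPMap.sup_le _ hSB hV) hdomain).symm⟩

end IsDissipative

theorem isDissipative_extension_iff (hS : IsStrictlyPositiveSymmetric S) (B : H →ₗ.[ℂ] H) :
    (I • S ≤ B ∧ IsDissipative B) ↔ ∃ P : ExtensionData hS, P.Condition ∧ B = P.op := by
  constructor
  · rintro ⟨hSB, hB⟩
    obtain ⟨P, rfl⟩ := hB.exists_eq_op hSB hS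
    exact ⟨P, P.isDissipative_op_iff.1 hB, rfl⟩
  · rintro ⟨P, hP, rfl⟩
    exact ⟨P.smul_le_op, P.isDissipative_op_iff.2 hP⟩

theorem isAccretive_extension_iff (hS : IsStrictlyPositiveSymmetric S) (C : H →ₗ.[ℂ] H) :
    (S ≤ C ∧ IsAccretive C) ↔ ∃ P : ExtensionData hS, P.Condition ∧ C = (-I) • P.op := by
  rw [← smul_le_smul_iff I_ne_zero, IsAccretive, isDissipative_extension_iff hS]
  simp only [← inv_I, eq_inv_smul_iff₀ I_ne_zero]

end Extension

end DissipativeExtension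

end

theorem theorem4p8 {H : Type*} [NormedAddCommGroup H] [InnerProductSpace ℂ H] [CompleteSpace H]
    (S : H →ₗ.[ℂ] H) (hS : IsStrictlyPositiveSymmetric S) :
    -- the square root `S_K^{1/2}` exists
    IsNonnegSqrt (krein S) (sqrt (krein S)) ∧
    -- `ℒ v + v ∈ D(S_K^{1/2})` always holds, so the condition is just the inequality
    (friedrichs hS).domain ≤ (sqrt (krein S)).domain ∧
    -- `A_{𝒱,ℒ}` is dissipative exactly when the condition holds
    (∀ P : ExtensionData hS, IsDissipative P.op ↔ P.Condition) ∧
    -- description of all dissipative extensions of `A = iS`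
    (∀ B : H →ₗ.[ℂ] H, (Complex.I • S ≤ B ∧ IsDissipative B) ↔
      ∃ P : ExtensionData hS, P.Condition ∧ B = P.op) ∧
    -- description of all accretive extensions of `S`
    (∀ C : H →ₗ.[ℂ] H, (S ≤ C ∧ IsAccretive C) ↔
      ∃ P : ExtensionData hS, P.Condition ∧ C = (-Complex.I) • P.op) := by
  have hR := hS.isNonnegSqrt_sqrt_krein
  exact ⟨hR, friedrichs_domain_le hR (le_krein hS.dense hS.symmetric),
    fun P => P.isDissipative_op_iff, isDissipative_extension_iff hS, isAccretive_extension_iff hS⟩
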